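/- Let $\mathbf{Hilb}$ be the category of complex Hilbert spaces and bounded linear maps, with the Hilbertian tensor product $\hat\otimes_2$ (the completed tensor product), its associativity constraint $\alpha$ and symmetry constraint $\sigma$; write $f^\dagger$ for the Hilbert adjoint of a bounded linear map $f$. A commutative Hilbertian Frobenius semigroup is a pair $(H,\mu)$ of a Hilbert space $H$ and a bounded linear map $\mu\colon H\hat\otimes_2 H\to H$ that is associative ($\mu\circ(\mu\hat\otimes_2 \mathrm{id})=\mu\circ(\mathrm{id}\hat\otimes_2\mu)\circ\alpha$), commutative ($\mu\circ\sigma=\mu$) and satisfies the Frobenius condition $$(\mu\hat\otimes_2\mathrm{id})\circ\alpha^{-1}\circ(\mathrm{id}\hat\otimes_2\mu^\dagger)=\mu^\dagger\circ\mu=(\mathrm{id}\hat\otimes_2\mu)\circ\alpha\circ(\mu^\dagger\hat\otimes_2\mathrm{id}).$$ A morphism $(H,\mu)\to(K,\gamma)$ is a bounded linear map $f$ with $f\circ\mu=\gamma\circ(f\hat\otimes_2 f)$. Let $J(H,\mu)$ be the Jacobson radical of the algebra $H$ with product $xy=\mu(x\otimes y)$, that is, the intersection of its maximal modular ideals ($J(H,\mu)=H$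 if there are none). Call $(H,\mu)$ semisimple if $J(H,\mu)=0$. Then the category ${}_c\mathbf{FrobSem}(\mathbb{Hilb})$ of commutative Hilbertian Frobenius semigroups is equivalent to the product ${}_{\mathsf{semisimple},c}\mathbf{FrobSem}(\mathbb{Hilb})\times\mathbf{Hilb}$, where the first factor is the full subcategory of semisimple objects. More precisely, for every object $(H,\mu)$ the radical $J(H,\mu)$ is closed, and $J(H,\mu)^\perp$ is a subalgebra which, with the restricted product $\mu|_{J(H,\mu)^\perp}$, is a semisimple commutative Hilbertian Frobenius semigroup; every morphism $f\colon(H,\mu)\to(K,\gamma)$ maps $J(H,\mu)$ into $J(K,\gamma)$ and $J(H,\mu)^\perp$ into $J(K,\gamma)^\perp$; and the resulting functor $$(H,\mu)\mapsto\bigl((J(H,\mu)^\perp,\mu|_{J(H,\mu)^\perp}),\,J(H,\mu)\bigr),\qquad f\mapsto\bigl(f|_{J(H,\mu)^\perp},\,f|_{J(H,\mu)}\bigr)$$ is an equivalence of categories. -/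

import Mathlib

open CategoryTheory
open scoped TensorProduct

universe u

noncomputable section

namespace HilbFrob

/-! ### The Hilbertian tensor product -/

section Tensor

variable {E F G H E' F' G' E'' F'' : Type*}
  [NormedAddCommGroup E] [InnerProductSpace ℂ E] [NormedAddCommGroup F] [InnerProductSpace ℂ F]
  [NormedAddCommGroup G] [InnerProductSpace ℂ G] [NormedAddCommGroup H] [InnerProductSpace ℂ H]
  [NormedAddCommGroup E'] [InnerProductSpace ℂ E'] [NormedAddCommGroup F'] [InnerProductSpace ℂ F']
  [NormedAddCommGroup G'] [InnerProductSpace ℂ G']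
  [NormedAddCommGroup E''] [InnerProductSpace ℂ E'']
  [NormedAddCommGroup F''] [InnerProductSpace ℂ F'']

/-- The Hilbertian tensor product: the completion of the algebraic tensor product over `ℂ`
for the inner product `⟪x ⊗ y, x' ⊗ y'⟫ = ⟪x, x'⟫ * ⟪y, y'⟫`. -/
abbrev HTensor (E F : Type*) [NormedAddCommGroup E] [InnerProductSpace ℂ E]
    [NormedAddCommGroup F] [InnerProductSpace ℂ F] : Type _ :=
  UniformSpace.Completion (E ⊗[ℂ] F)

/-- The elementary tensor `x ⊗ y` in the Hilbertian tensor product. -/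
def htmul (x : E) (y : F) : HTensor E F := ((x ⊗ₜ[ℂ] y : E ⊗[ℂ] F) : UniformSpace.Completion _)

/-- The tensor product of two bounded linear maps, extended to the completions. -/
def hmap (f : E →L[ℂ] E') (g : F →L[ℂ] F') : HTensor E F →L[ℂ] HTensor E' F' :=
  ((UniformSpace.Completion.toComplL (𝕜 := ℂ)).comp (TensorProduct.mapL f g)).extend
    (UniformSpace.Completion.toComplL (𝕜 := ℂ) (E := E ⊗[ℂ] F))

theorem hmap_coe (f : E →L[ℂ] E') (g : F →L[ℂ] F') (t : E ⊗[ℂ] F) :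
    hmap f g (t : HTensor E F) = ((TensorProduct.mapL f g t : E' ⊗[ℂ] F') : HTensor E' F') :=
  ContinuousLinearMap.extend_eq
    ((UniformSpace.Completion.toComplL (𝕜 := ℂ)).comp (TensorProduct.mapL f g))
    (e := UniformSpace.Completion.toComplL (𝕜 := ℂ) (E := E ⊗[ℂ] F))
    UniformSpace.Completion.denseRange_coe
    (UniformSpace.Completion.isUniformInducing_coe _) t

@[simp] theorem hmap_htmul (f : E →L[ℂ] E') (g : F →L[ℂ] F') (x : E) (y : F) :
    hmap f g (htmul x y) = htmul (f x) (g y) := by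
  rw [htmul, hmap_coe]
  rfl

theorem continuous_htmul : Continuous fun p : E × F => (htmul p.1 p.2 : HTensor E F) :=
  (UniformSpace.Completion.continuous_coe _).comp TensorProduct.continuous_tmul

/-- Bounded linear maps agreeing on elementary tensors are equal. -/
theorem hext {f g : HTensor E F →L[ℂ] H} (h : ∀ x y, f (htmul x y) = g (htmul x y)) : f = g := by
  ext t
  induction t using UniformSpace.Completion.induction_on with
  | hp => exact isClosed_eq f.continuous g.continuous
  | ih a =>
    induction a using TensorProduct.induction_on with
    | zero => rw [UniformSpace.Completion.coe_zero, map_zero, map_zero]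
    | tmul x y => exact h x y
    | add a b ha hb => rw [UniformSpace.Completion.coe_add, map_add, map_add, ha, hb]

theorem hext₃ {f g : HTensor (HTensor E F) G →L[ℂ] H}
    (h : ∀ x y z, f (htmul (htmul x y) z) = g (htmul (htmul x y) z)) : f = g := by
  refine hext fun t z => ?_
  induction t using UniformSpace.Completion.induction_on with
  | hp =>
    have hc : Continuous fun t : HTensor E F => (htmul t z : HTensor (HTensor E F) G) :=
      continuous_htmul.comp (by fun_prop : Continuous fun t : HTensor E F => (t, z))
    exact isClosed_eq (f.continuous.comp hc) (g.continuous.comp hc)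
  | ih a =>
    induction a using TensorProduct.induction_on with
    | zero =>
      have : (htmul ((0 : E ⊗[ℂ] F) : HTensor E F) z : HTensor (HTensor E F) G) = 0 := by
        rw [htmul, UniformSpace.Completion.coe_zero, TensorProduct.zero_tmul,
          UniformSpace.Completion.coe_zero]
      rw [this, map_zero, map_zero]
    | tmul x y => exact h x y z
    | add a b ha hb =>
      have : (htmul ((a + b : E ⊗[ℂ] F) : HTensor E F) z : HTensor (HTensor E F) G)
          = htmul (a : HTensor E F) z + htmul (b : HTensor E F) z := by
        rw [htmul, UniformSpace.Completion.coe_add, TensorProduct.add_tmul,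
          UniformSpace.Completion.coe_add]
        rfl
      rw [this, map_add, map_add, ha, hb]

theorem hmap_comp (f : E →L[ℂ] E') (f' : E' →L[ℂ] E'') (g : F →L[ℂ] F') (g' : F' →L[ℂ] F'') :
    hmap (f'.comp f) (g'.comp g) = (hmap f' g').comp (hmap f g) :=
  hext fun x y => by simp

@[simp] theorem hmap_id :
    hmap (ContinuousLinearMap.id ℂ E) (ContinuousLinearMap.id ℂ F) = ContinuousLinearMap.id ℂ _ :=
  hext fun x y => by simp

/-- The symmetry constraint `x ⊗ y ↦ y ⊗ x`, a unitary. -/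
def hcomm (E F : Type*) [NormedAddCommGroup E] [InnerProductSpace ℂ E]
    [NormedAddCommGroup F] [InnerProductSpace ℂ F] : HTensor E F ≃ₗᵢ[ℂ] HTensor F E :=
  (TensorProduct.comm ℂ E F).extendOfIsometry
    (UniformSpace.Completion.toComplₗᵢ (𝕜 := ℂ) (E := E ⊗[ℂ] F)).toLinearMap
    (UniformSpace.Completion.toComplₗᵢ (𝕜 := ℂ) (E := F ⊗[ℂ] E)).toLinearMap
    UniformSpace.Completion.denseRange_coe UniformSpace.Completion.denseRange_coe
    (fun x => by simp)

@[simp] theorem hcomm_htmul (x : E) (y : F) : hcomm E F (htmul x y) = htmul y x :=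
  LinearEquiv.extendOfIsometry_eq (TensorProduct.comm ℂ E F) _ _ _ _ _ (x ⊗ₜ y)

/-- The inclusion of `(E ⊗ F) ⊗ G` in its double completion. -/
def inclL (E F G : Type*) [NormedAddCommGroup E] [InnerProductSpace ℂ E]
    [NormedAddCommGroup F] [InnerProductSpace ℂ F] [NormedAddCommGroup G] [InnerProductSpace ℂ G] :
    (E ⊗[ℂ] F) ⊗[ℂ] G →ₗᵢ[ℂ] HTensor (HTensor E F) G :=
  UniformSpace.Completion.toComplₗᵢ.comp
    ((UniformSpace.Completion.toComplₗᵢ (𝕜 := ℂ) (E := E ⊗[ℂ] F)).rTensor G)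

/-- The inclusion of `E ⊗ (F ⊗ G)` in its double completion. -/
def inclR (E F G : Type*) [NormedAddCommGroup E] [InnerProductSpace ℂ E]
    [NormedAddCommGroup F] [InnerProductSpace ℂ F] [NormedAddCommGroup G] [InnerProductSpace ℂ G] :
    E ⊗[ℂ] (F ⊗[ℂ] G) →ₗᵢ[ℂ] HTensor E (HTensor F G) :=
  UniformSpace.Completion.toComplₗᵢ.comp
    ((UniformSpace.Completion.toComplₗᵢ (𝕜 := ℂ) (E := F ⊗[ℂ] G)).lTensor E)

theorem denseRange_map {f : E →ₗᵢ[ℂ] E'} {g : F →ₗᵢ[ℂ] F'} (hf : DenseRange f)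
    (hg : DenseRange g) : DenseRange (TensorProduct.mapIsometry f g) := by
  have hmem : ∀ t, t ∈ closure (Set.range (TensorProduct.mapIsometry f g)) := by
    intro t
    have hcl : ∀ t, t ∈ closure (Set.range (TensorProduct.mapIsometry f g)) ↔
        t ∈ (LinearMap.range (TensorProduct.mapIsometry f g).toLinearMap).topologicalClosure := by
      intro t; rfl
    rw [hcl]
    induction t using TensorProduct.induction_on with
    | zero => exact zero_mem _
    | add a b ha hb => exact add_mem ha hb
    | tmul x y =>
      rw [← hcl]
      have hc : Continuous fun p : E' × F' => p.1 ⊗ₜ[ℂ] p.2 := TensorProduct.continuous_tmul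
      have hd : DenseRange (Prod.map f g) := hf.prodMap hg
      refine closure_mono ?_ (hc.range_subset_closure_image_dense hd ⟨(x, y), rfl⟩)
      rintro _ ⟨_, ⟨p, rfl⟩, rfl⟩
      exact ⟨p.1 ⊗ₜ p.2, by simp⟩
  exact hmem

theorem denseRange_inclL : DenseRange (inclL E F G) :=
  UniformSpace.Completion.denseRange_coe.comp
    (denseRange_map UniformSpace.Completion.denseRange_coe Function.surjective_id.denseRange)
    (UniformSpace.Completion.continuous_coe _)

theorem denseRange_inclR : DenseRange (inclR E F G) :=
  UniformSpace.Completion.denseRange_coe.comp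
    (denseRange_map Function.surjective_id.denseRange UniformSpace.Completion.denseRange_coe)
    (UniformSpace.Completion.continuous_coe _)

/-- The associativity constraint `(x ⊗ y) ⊗ z ↦ x ⊗ (y ⊗ z)`, a unitary. -/
def hassoc (E F G : Type*) [NormedAddCommGroup E] [InnerProductSpace ℂ E]
    [NormedAddCommGroup F] [InnerProductSpace ℂ F] [NormedAddCommGroup G] [InnerProductSpace ℂ G] :
    HTensor (HTensor E F) G ≃ₗᵢ[ℂ] HTensor E (HTensor F G) :=
  (TensorProduct.assoc ℂ E F G).extendOfIsometry
    (inclL E F G).toLinearMap (inclR E F G).toLinearMap denseRange_inclL denseRange_inclR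
    (fun x => ((inclR E F G).norm_map _).trans
      ((TensorProduct.norm_assoc x).trans ((inclL E F G).norm_map x).symm))

@[simp] theorem hassoc_htmul (x : E) (y : F) (z : G) :
    hassoc E F G (htmul (htmul x y) z) = htmul x (htmul y z) :=
  LinearEquiv.extendOfIsometry_eq (TensorProduct.assoc ℂ E F G) (inclL E F G).toLinearMap
    (inclR E F G).toLinearMap denseRange_inclL denseRange_inclR _ ((x ⊗ₜ y) ⊗ₜ z)

end Tensor

/-! ### Bounded multiplications on a Hilbert space -/

section Mul

variable {H : Type*} [NormedAddCommGroup H] [InnerProductSpace ℂ H]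

/-- Associativity, as a commuting diagram: `μ ∘ (μ ⊗ id) = μ ∘ (id ⊗ μ) ∘ α`. -/
def IsAssoc (μ : HTensor H H →L[ℂ] H) : Prop :=
  μ ∘L hmap μ (.id ℂ H) = μ ∘L hmap (.id ℂ H) μ ∘L (hassoc H H H : _ →L[ℂ] _)

/-- Commutativity: `μ ∘ σ = μ`. -/
def IsComm (μ : HTensor H H →L[ℂ] H) : Prop :=
  μ ∘L (hcomm H H : _ →L[ℂ] _) = μ

/-- The dagger-Frobenius condition (both cells):
`(μ ⊗ id) ∘ α⁻¹ ∘ (id ⊗ μ†) = μ† ∘ μ` and `(id ⊗ μ) ∘ α ∘ (μ† ⊗ id) = μ† ∘ μ`. -/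
def IsFrobenius [CompleteSpace H] (μ : HTensor H H →L[ℂ] H) : Prop :=
  hmap μ (.id ℂ H) ∘L ((hassoc H H H).symm : _ →L[ℂ] _) ∘L
      hmap (.id ℂ H) (ContinuousLinearMap.adjoint μ) = ContinuousLinearMap.adjoint μ ∘L μ ∧
  hmap (.id ℂ H) μ ∘L (hassoc H H H : _ →L[ℂ] _) ∘L
      hmap (ContinuousLinearMap.adjoint μ) (.id ℂ H) = ContinuousLinearMap.adjoint μ ∘L μ

/-- Left ideals of the underlying (non-unital) complex algebra, with product
`xy = μ (x ⊗ y)`. -/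
def IsLeftIdeal (μ : HTensor H H →L[ℂ] H) (I : Submodule ℂ H) : Prop :=
  ∀ x y, y ∈ I → μ (htmul x y) ∈ I

/-- `I` is modular: there is a right identity `e` modulo `I`. -/
def IsModular (μ : HTensor H H →L[ℂ] H) (I : Submodule ℂ H) : Prop :=
  ∃ e, ∀ x, x - μ (htmul x e) ∈ I

/-- Maximal modular left ideals: modular, and maximal among the proper left ideals. -/
def IsMaximalModular (μ : HTensor H H →L[ℂ] H) (I : Submodule ℂ H) : Prop :=
  IsModular μ I ∧ Maximal (fun K => IsLeftIdeal μ K ∧ K ≠ ⊤) I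

/-- The Jacobson radical: the intersection of all maximal modular left ideals
(the whole algebra if there are none). -/
def jacobson (μ : HTensor H H →L[ℂ] H) : Submodule ℂ H :=
  sInf {I | IsMaximalModular μ I}

/-- `V` is closed under multiplication: `μ (V ⊗ V) ⊆ V`. -/
def IsSubalgebra (μ : HTensor H H →L[ℂ] H) (V : Submodule ℂ H) : Prop :=
  ∀ t : HTensor V V, μ (hmap V.subtypeL V.subtypeL t) ∈ V

/-- The restriction and co-restriction of `μ` to a subalgebra. -/
def restrictMul (μ : HTensor H H →L[ℂ] H) (V : Submodule ℂ H) (hV : IsSubalgebra μ V) :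
    HTensor V V →L[ℂ] V :=
  (μ ∘L hmap V.subtypeL V.subtypeL).codRestrict V hV

@[simp] theorem coe_restrictMul_htmul (μ : HTensor H H →L[ℂ] H) (V : Submodule ℂ H)
    (hV : IsSubalgebra μ V) (x y : V) :
    (restrictMul μ V hV (htmul x y) : H) = μ (htmul (x : H) (y : H)) :=
  congrArg μ (hmap_htmul V.subtypeL V.subtypeL x y)

theorem restrict_comp_restrictMul {K : Type*} [NormedAddCommGroup K] [InnerProductSpace ℂ K]
    {μ : HTensor H H →L[ℂ] H} {γ : HTensor K K →L[ℂ] K} {f : H →L[ℂ] K}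
    (hμγ : f ∘L μ = γ ∘L hmap f f) {V : Submodule ℂ H} {W : Submodule ℂ K}
    (hV : IsSubalgebra μ V) (hW : IsSubalgebra γ W) (hf : ∀ x ∈ V, f x ∈ W) :
    f.restrict hf ∘L restrictMul μ V hV =
      restrictMul γ W hW ∘L hmap (f.restrict hf) (f.restrict hf) :=
  hext fun x y => by
    have h : f (μ (htmul (x : H) (y : H))) = γ (htmul (f x) (f y)) := by
      simpa using DFunLike.congr_fun hμγ (htmul (x : H) (y : H))
    rw [ContinuousLinearMap.comp_apply, ContinuousLinearMap.comp_apply, hmap_htmul]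
    apply Subtype.ext
    rw [coe_restrictMul_htmul]
    exact (congrArg f (coe_restrictMul_htmul μ V hV x y)).trans h

theorem isAssoc_iff (μ : HTensor H H →L[ℂ] H) :
    IsAssoc μ ↔ ∀ x y z, μ (htmul (μ (htmul x y)) z) = μ (htmul x (μ (htmul y z))) := by
  refine ⟨fun h x y z => ?_, fun h => hext₃ fun x y z => ?_⟩
  · simpa using DFunLike.congr_fun h (htmul (htmul x y) z)
  · simpa using h x y z

theorem isComm_iff (μ : HTensor H H →L[ℂ] H) :
    IsComm μ ↔ ∀ x y, μ (htmul y x) = μ (htmul x y) := by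
  refine ⟨fun h x y => ?_, fun h => hext fun x y => ?_⟩
  · simpa using DFunLike.congr_fun h (htmul x y)
  · simpa using h x y

theorem IsAssoc.restrict {μ : HTensor H H →L[ℂ] H} (h : IsAssoc μ) (V : Submodule ℂ H)
    (hV : IsSubalgebra μ V) : IsAssoc (restrictMul μ V hV) := by
  rw [isAssoc_iff] at h ⊢
  intro x y z
  ext
  simpa using h x y z

theorem IsComm.restrict {μ : HTensor H H →L[ℂ] H} (h : IsComm μ) (V : Submodule ℂ H)
    (hV : IsSubalgebra μ V) : IsComm (restrictMul μ V hV) := by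
  rw [isComm_iff] at h ⊢
  intro x y
  ext
  simpa using h x y

end Mul

/-! ### The categories -/

/-- Complex Hilbert spaces. -/
structure Hilb : Type (u + 1) where
  carrier : Type u
  [normed : NormedAddCommGroup carrier]
  [innerProduct : InnerProductSpace ℂ carrier]
  [complete : CompleteSpace carrier]

attribute [instance] Hilb.normed Hilb.innerProduct Hilb.complete

/-- Morphisms of Hilbert spaces: bounded linear maps. -/
@[ext] structure Hilb.Hom (H K : Hilb.{u}) : Type u where
  toCLM : H.carrier →L[ℂ] K.carrier

instance : Category Hilb.{u} where
  Hom := Hilb.Hom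
  id H := ⟨.id ℂ H.carrier⟩
  comp f g := ⟨g.toCLM ∘L f.toCLM⟩

/-- Commutative semigroup objects in the symmetric monoidal category of Hilbert spaces. -/
structure CSem : Type (u + 1) extends Hilb.{u} where
  mul : HTensor carrier carrier →L[ℂ] carrier
  assoc : IsAssoc mul
  comm : IsComm mul

/-- Semigroup morphisms: bounded linear maps `f` with `f ∘ μ = γ ∘ (f ⊗ f)`. -/
@[ext] structure CSem.Hom (X Y : CSem.{u}) : Type u where
  toCLM : X.carrier →L[ℂ] Y.carrier
  map_mul : toCLM ∘L X.mul = Y.mul ∘L hmap toCLM toCLM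

instance : Category CSem.{u} where
  Hom := CSem.Hom
  id X := ⟨.id ℂ X.carrier, by simp⟩
  comp f g := ⟨g.toCLM ∘L f.toCLM, by
    rw [ContinuousLinearMap.comp_assoc, f.map_mul, ← ContinuousLinearMap.comp_assoc, g.map_mul,
      ContinuousLinearMap.comp_assoc, hmap_comp]⟩

/-- The category of commutative Hilbertian Frobenius semigroups, a full subcategory of the
category of commutative semigroups. -/
abbrev CFrobSem : Type (u + 1) :=
  ObjectProperty.FullSubcategory fun X : CSem.{u} => IsFrobenius X.mul

/-- The Jacobson radical `J(H, μ)` of an object. -/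
abbrev radical (X : CFrobSem.{u}) : Submodule ℂ X.obj.carrier := jacobson X.obj.mul

/-- The full subcategory of semisimple objects: those with zero radical. -/
abbrev SemisimpleCFrobSem : Type (u + 1) :=
  ObjectProperty.FullSubcategory fun X : CFrobSem.{u} => radical X = ⊥

/-- A closed subalgebra as a commutative semigroup on its own, with the restricted product. -/
def CSem.restrict (X : CSem.{u}) (V : Submodule ℂ X.carrier) [CompleteSpace V]
    (hV : IsSubalgebra X.mul V) : CSem.{u} where
  carrier := V
  mul := restrictMul X.mul V hV
  assoc := X.assoc.restrict V hV
  comm := X.comm.restrict V hV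

/-- A morphism restricts to subalgebras that it maps into each other. -/
def CSem.Hom.restrict {X Y : CSem.{u}} (f : X ⟶ Y) {V : Submodule ℂ X.carrier}
    {W : Submodule ℂ Y.carrier} [CompleteSpace V] [CompleteSpace W]
    (hV : IsSubalgebra X.mul V) (hW : IsSubalgebra Y.mul W)
    (hf : ∀ x ∈ V, f.toCLM x ∈ W) : X.restrict V hV ⟶ Y.restrict W hW where
  toCLM := f.toCLM.restrict hf
  map_mul := restrict_comp_restrictMul f.map_mul hV hW hf

/-! ### The two functors

Their well-definedness (that `Jᗮ` is a semisimple Frobenius subalgebra, that `J` is closed, and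
that morphisms preserve both) is not built in; it enters through the arguments below. -/

/-- `P(H, μ) = (Jᗮ, μ restricted to Jᗮ)` and `P(f)` is `f` restricted to the complements. -/
def functorP
    (hsub : ∀ X : CFrobSem.{u}, IsSubalgebra X.obj.mul (radical X)ᗮ)
    (hfrob : ∀ X : CFrobSem.{u}, IsFrobenius (restrictMul X.obj.mul (radical X)ᗮ (hsub X)))
    (hss : ∀ X : CFrobSem.{u}, jacobson (restrictMul X.obj.mul (radical X)ᗮ (hsub X)) = ⊥)
    (hmaps : ∀ (X Y : CFrobSem.{u}) (f : X ⟶ Y), ∀ x ∈ (radical X)ᗮ, f.hom.toCLM x ∈ (radical Y)ᗮ) :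
    CFrobSem.{u} ⥤ SemisimpleCFrobSem.{u} where
  obj X := ⟨⟨X.obj.restrict (radical X)ᗮ (hsub X), hfrob X⟩, hss X⟩
  map {X Y} f := ObjectProperty.homMk (ObjectProperty.homMk
    (CSem.Hom.restrict f.hom (hsub X) (hsub Y) (hmaps X Y f)))
  map_id _ := rfl
  map_comp _ _ := rfl

/-- `J(H, μ)` as a Hilbert space, and `J(f)` is `f` restricted to the radicals. -/
def functorJ
    (hclosed : ∀ X : CFrobSem.{u}, IsClosed (radical X : Set X.obj.carrier))
    (hmaps : ∀ (X Y : CFrobSem.{u}) (f : X ⟶ Y), ∀ x ∈ radical X, f.hom.toCLM x ∈ radical Y) :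
    CFrobSem.{u} ⥤ Hilb.{u} where
  obj X := @Hilb.mk (radical X) _ _ (hclosed X).completeSpace_coe
  map {X Y} f := ⟨f.hom.toCLM.restrict (hmaps X Y f)⟩
  map_id _ := rfl
  map_comp _ _ := rfl

end HilbFrob

end

noncomputable section

namespace HilbFrob

/-! ### Elementary tensors and inner products -/

section Tensor

variable {E F G H : Type*}
  [NormedAddCommGroup E] [InnerProductSpace ℂ E] [NormedAddCommGroup F] [InnerProductSpace ℂ F]
  [NormedAddCommGroup G] [InnerProductSpace ℂ G] [NormedAddCommGroup H] [InnerProductSpace ℂ H]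

/-! Write L_x for multiplication by x. Paired with elementary tensors, the Frobenius condition for a
commutative product says exactly that L_x†(uv) = (L_x†u)v (`IsFrobenius.adjoint_lmul_mul`, converse
`IsComm.isFrobenius`). Hence L_x†L_x u = (L_x†u)x = L_x L_x†u, so every L_x is normal.

If x is in the radical J, all its multiples are quasi-regular, so the spectrum of L_x lies in {0}. A
normal operator has norm equal to its spectral radius, so L_x = 0. Thus J is the annihilator of the
algebra (`IsFrobenius.mem_jacobson_iff`).

Normality also gives ker L_x = ker L_x†. It follows that J is the orthogonal complement of the set
of products, and that elements of square zero lie in J. Morphisms preserve squares and products, so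
they respect J and, through the adjoint, Jᗮ.

Finally H = Jᗮ ⊕ J, where products ignore the J components and land in Jᗮ. A morphism is therefore
an algebra map between the complements together with an arbitrary bounded map between the radicals.
The sum of a semisimple S and a Hilbert space Z with zero product realises each pair (S, Z). -/

theorem inner_htmul (x x' : E) (y y' : F) :
    inner ℂ (htmul x y) (htmul x' y') = inner ℂ x x' * inner ℂ y y' := by
  rw [htmul, htmul, UniformSpace.Completion.inner_coe, TensorProduct.inner_tmul]

/-- Elements of `E ⊗ F` are determined by their inner products with elementary tensors. -/
theorem ext_inner_htmul {s t : HTensor E F}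
    (h : ∀ x y, inner ℂ (htmul x y) s = inner ℂ (htmul x y) t) : s = t := by
  have : innerSL ℂ s = innerSL ℂ t := hext fun x y => by
    rw [innerSL_apply_apply, innerSL_apply_apply, ← inner_conj_symm, h, inner_conj_symm]
  exact ext_inner_right ℂ fun v => by simpa using DFunLike.congr_fun this v

/-- Tensoring with `x` on the left, as a bounded linear map. -/
def htmulLeft (F : Type*) [NormedAddCommGroup F] [InnerProductSpace ℂ F] (x : E) :
    F →L[ℂ] HTensor E F :=
  (UniformSpace.Completion.toComplL (𝕜 := ℂ) (E := E ⊗[ℂ] F)).comp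
    ((TensorProduct.mk ℂ E F x).mkContinuous ‖x‖ fun y => by simp)

/-- Tensoring with `y` on the right, as a bounded linear map. -/
def htmulRight (E : Type*) [NormedAddCommGroup E] [InnerProductSpace ℂ E] (y : F) :
    E →L[ℂ] HTensor E F :=
  (hcomm F E : _ →L[ℂ] _) ∘L htmulLeft E y

@[simp] theorem htmulLeft_apply (x : E) (y : F) : htmulLeft F x y = htmul x y := rfl

@[simp] theorem htmulRight_apply (x : E) (y : F) : htmulRight E y x = htmul x y := by
  simp [htmulRight]

theorem htmul_smul_left (c : ℂ) (x : E) (y : F) : htmul (c • x) y = c • htmul x y := by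
  rw [← htmulRight_apply, map_smul, htmulRight_apply]

/-- The adjoint `g` is a bare function, so that explicit candidates need no proof of linearity or
boundedness. -/
theorem inner_htmul_hmap_id (f : E →L[ℂ] G) (g : G → E)
    (hfg : ∀ u x, inner ℂ (g u) x = inner ℂ u (f x)) (u : G) (v : F) (t : HTensor E F) :
    inner ℂ (htmul u v) (hmap f (.id ℂ F) t) = inner ℂ (htmul (g u) v) t := by
  have : innerSL ℂ (htmul u v) ∘L hmap f (.id ℂ F) = innerSL ℂ (htmul (g u) v) :=
    hext fun x y => by simp [inner_htmul, hfg]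
  simpa using DFunLike.congr_fun this t

theorem inner_htmul_hmap_id_left (f : F →L[ℂ] G) (g : G → F)
    (hfg : ∀ u x, inner ℂ (g u) x = inner ℂ u (f x)) (u : E) (v : G) (t : HTensor E F) :
    inner ℂ (htmul u v) (hmap (.id ℂ E) f t) = inner ℂ (htmul u (g v)) t := by
  have : innerSL ℂ (htmul u v) ∘L hmap (.id ℂ E) f = innerSL ℂ (htmul u (g v)) :=
    hext fun x y => by simp [inner_htmul, hfg]
  simpa using DFunLike.congr_fun this t

theorem inner_apply_eq_zero {f : HTensor E F →L[ℂ] H} {z : H}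
    (h : ∀ x y, inner ℂ z (f (htmul x y)) = 0) (t : HTensor E F) : inner ℂ z (f t) = 0 := by
  have : innerSL ℂ z ∘L f = 0 := hext fun x y => by simpa using h x y
  simpa using DFunLike.congr_fun this t

end Tensor

section Mul

variable {H : Type*} [NormedAddCommGroup H] [InnerProductSpace ℂ H]

/-! ### Multiplication operators and the Frobenius condition -/

/-- Left multiplication by `x`. -/
def lmul (μ : HTensor H H →L[ℂ] H) (x : H) : H →L[ℂ] H := μ ∘L htmulLeft H x

@[simp] theorem lmul_apply (μ : HTensor H H →L[ℂ] H) (x y : H) : lmul μ x y = μ (htmul x y) := rfl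

theorem IsComm.mul_comm {μ : HTensor H H →L[ℂ] H} (h : IsComm μ) (x y : H) :
    μ (htmul x y) = μ (htmul y x) := (isComm_iff μ).1 h y x

theorem lmul_smul (μ : HTensor H H →L[ℂ] H) (c : ℂ) (x : H) : lmul μ (c • x) = c • lmul μ x := by
  ext y
  simp [htmul_smul_left]

/-- On x ⊗ y the left cell becomes an amplification of L_x applied to μ†y, which turns the diagram
into a statement about operators. -/
theorem frobenius_left_apply [CompleteSpace H] (μ : HTensor H H →L[ℂ] H) (x y : H) :
    (hmap μ (.id ℂ H) ∘L ((hassoc H H H).symm : _ →L[ℂ] _) ∘L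
      hmap (.id ℂ H) (ContinuousLinearMap.adjoint μ)) (htmul x y) =
    hmap (lmul μ x) (.id ℂ H) (ContinuousLinearMap.adjoint μ y) := by
  have h : hmap μ (.id ℂ H) ∘L ((hassoc H H H).symm : _ →L[ℂ] _) ∘L htmulLeft (HTensor H H) x =
      hmap (lmul μ x) (.id ℂ H) := hext fun u v => by
    have h' : (hassoc H H H).symm (htmul x (htmul u v)) = htmul (htmul x u) v := by
      rw [LinearIsometryEquiv.symm_apply_eq, hassoc_htmul]
    simp [h']
  simpa using DFunLike.congr_fun h (ContinuousLinearMap.adjoint μ y)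

theorem frobenius_right_apply [CompleteSpace H] {μ : HTensor H H →L[ℂ] H} (hμ : IsComm μ)
    (x y : H) :
    (hmap (.id ℂ H) μ ∘L (hassoc H H H : _ →L[ℂ] _) ∘L
      hmap (ContinuousLinearMap.adjoint μ) (.id ℂ H)) (htmul x y) =
    hmap (.id ℂ H) (lmul μ y) (ContinuousLinearMap.adjoint μ x) := by
  have h : hmap (.id ℂ H) μ ∘L (hassoc H H H : _ →L[ℂ] _) ∘L htmulRight (HTensor H H) y =
      hmap (.id ℂ H) (lmul μ y) := hext fun u v => by
    simp [hμ.mul_comm y v]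
  simpa using DFunLike.congr_fun h (ContinuousLinearMap.adjoint μ x)

/-- The left cell at x ⊗ y reads (L_x ⊗ id)μ†y = μ†(xy); pairing it with u ⊗ v gives ⟪(L_x†u)v, y⟫ =
⟪uv, xy⟫. -/
theorem IsFrobenius.adjoint_lmul_mul [CompleteSpace H] {μ : HTensor H H →L[ℂ] H}
    (h : IsFrobenius μ) (x u v : H) :
    ContinuousLinearMap.adjoint (lmul μ x) (μ (htmul u v)) =
      μ (htmul (ContinuousLinearMap.adjoint (lmul μ x) u) v) := by
  refine ext_inner_right ℂ fun y => ?_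
  have h1 := DFunLike.congr_fun h.1 (htmul x y)
  rw [frobenius_left_apply] at h1
  have h2 := inner_htmul_hmap_id (lmul μ x) (ContinuousLinearMap.adjoint (lmul μ x))
    (fun u y => ContinuousLinearMap.adjoint_inner_left _ _ _) u v (ContinuousLinearMap.adjoint μ y)
  rw [h1, ContinuousLinearMap.comp_apply, ContinuousLinearMap.adjoint_inner_right,
    ContinuousLinearMap.adjoint_inner_right] at h2
  rw [ContinuousLinearMap.adjoint_inner_left, lmul_apply, h2]

/-- For a commutative product, the Frobenius condition follows if every multiplication operator
has an adjoint that is a module map. -/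
theorem IsComm.isFrobenius [CompleteSpace H] {μ : HTensor H H →L[ℂ] H} (hc : IsComm μ)
    (h : ∀ x, ∃ T : H → H, (∀ u y, inner ℂ (T u) y = inner ℂ u (μ (htmul x y))) ∧
      ∀ u v, T (μ (htmul u v)) = μ (htmul (T u) v)) : IsFrobenius μ := by
  refine ⟨hext fun x y => ?_, hext fun x y => ?_⟩
  · obtain ⟨T, hT, hTm⟩ := h x
    rw [frobenius_left_apply]
    refine ext_inner_htmul fun u v => ?_
    rw [inner_htmul_hmap_id (lmul μ x) T hT, ContinuousLinearMap.comp_apply,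
      ContinuousLinearMap.adjoint_inner_right, ContinuousLinearMap.adjoint_inner_right, ← hTm, hT]
  · obtain ⟨T, hT, hTm⟩ := h y
    rw [frobenius_right_apply hc]
    refine ext_inner_htmul fun u v => ?_
    rw [inner_htmul_hmap_id_left (lmul μ y) T hT, ContinuousLinearMap.comp_apply,
      ContinuousLinearMap.adjoint_inner_right, ContinuousLinearMap.adjoint_inner_right,
      hc.mul_comm x y, hc.mul_comm u v, ← hT, hTm, hc.mul_comm]

/-- Multiplication operators of a commutative Frobenius semigroup are normal. -/
theorem IsFrobenius.isStarNormal_lmul [CompleteSpace H] {μ : HTensor H H →L[ℂ] H}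
    (h : IsFrobenius μ) (hc : IsComm μ) (x : H) : IsStarNormal (lmul μ x) := by
  refine ⟨ContinuousLinearMap.ext fun u => ?_⟩
  simp only [ContinuousLinearMap.star_eq_adjoint, mul_apply_eq_comp, lmul_apply]
  rw [hc.mul_comm x u, h.adjoint_lmul_mul, hc.mul_comm]

/-! ### The radical -/

/-- By commutativity, x(z - yz) = xz - y(xz). -/
theorem isLeftIdeal_range_id_sub_lmul {μ : HTensor H H →L[ℂ] H} (ha : IsAssoc μ) (hc : IsComm μ)
    (y : H) : IsLeftIdeal μ (ContinuousLinearMap.id ℂ H - lmul μ y).range := by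
  rintro x _ ⟨z, rfl⟩
  refine ⟨μ (htmul x z), ?_⟩
  have h := (lmul μ x).map_sub z (μ (htmul y z))
  simp only [lmul_apply] at h
  have h2 := (isAssoc_iff μ).1 ha
  simp [h, ← h2, hc.mul_comm x y]

/-- A left ideal with right identity `y` modulo it and not containing `y` lies in a maximal
modular left ideal not containing `y`. -/
theorem exists_isMaximalModular {μ : HTensor H H →L[ℂ] H} {I : Submodule ℂ H}
    (hI : IsLeftIdeal μ I) {y : H} (hy : ∀ x, x - μ (htmul x y) ∈ I) (hyI : y ∉ I) :
    ∃ M, IsMaximalModular μ M ∧ y ∉ M := by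
  obtain ⟨M, hIM, hM⟩ := zorn_le_nonempty₀ {K : Submodule ℂ H | IsLeftIdeal μ K ∧ y ∉ K}
    (fun c hcs hc K hK => by
      have hdir : DirectedOn (· ≤ ·) c := hc.directedOn
      refine ⟨sSup c, ⟨fun x z hz => ?_, fun hz => ?_⟩, fun z hz => le_sSup hz⟩
      · rw [Submodule.mem_sSup_of_directed ⟨K, hK⟩ hdir] at hz ⊢
        obtain ⟨L, hL, hzL⟩ := hz
        exact ⟨L, hL, (hcs hL).1 x z hzL⟩
      · rw [Submodule.mem_sSup_of_directed ⟨K, hK⟩ hdir] at hz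
        obtain ⟨L, hL, hzL⟩ := hz
        exact (hcs hL).2 hzL) I ⟨hI, hyI⟩
  refine ⟨M, ⟨⟨y, fun x => hIM (hy x)⟩, ⟨hM.prop.1, fun h => hM.prop.2 (h ▸ trivial)⟩, ?_⟩,
    hM.prop.2⟩
  rintro K ⟨hK, hKtop⟩ hMK
  -- A left ideal above `M` that contains `y` contains both z - zy and zy, hence every z. So a
  -- proper one still avoids `y`, and maximality in the Zorn family applies.
  refine hM.le_of_ge ⟨hK, fun hyK => hKtop (eq_top_iff.2 fun z _ => ?_)⟩ hMK
  rw [← sub_add_cancel z (μ (htmul z y))]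
  exact K.add_mem (hMK (hIM (hy z))) (hK z y hyK)

/-- Elements of the radical are quasi-regular. -/
theorem range_id_sub_lmul_of_mem_jacobson {μ : HTensor H H →L[ℂ] H} (ha : IsAssoc μ)
    (hc : IsComm μ) {y : H} (hy : y ∈ jacobson μ) :
    (ContinuousLinearMap.id ℂ H - lmul μ y).range = ⊤ := by
  set I := (ContinuousLinearMap.id ℂ H - lmul μ y).range with hIdef
  have hmod : ∀ x, x - μ (htmul x y) ∈ I := fun z => ⟨z, by simp [hc.mul_comm y z]⟩
  have hI : IsLeftIdeal μ I := isLeftIdeal_range_id_sub_lmul ha hc y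
  -- Otherwise some maximal modular ideal would miss `y`, although `y` lies in all of them.
  have hyI : y ∈ I := by
    by_contra hyI
    obtain ⟨M, hM, hyM⟩ := exists_isMaximalModular hI hmod hyI
    exact hyM (Submodule.mem_sInf.1 hy M hM)
  refine eq_top_iff.2 fun z _ => ?_
  rw [← sub_add_cancel z (μ (htmul z y))]
  exact I.add_mem (hmod z) (hI z y hyI)

/-- If e is a right identity modulo I, then x = x - xe ∈ I. -/
theorem mem_jacobson_of_mul_eq_zero {μ : HTensor H H →L[ℂ] H} {x : H}
    (hx : ∀ y, μ (htmul x y) = 0) : x ∈ jacobson μ := by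
  refine Submodule.mem_sInf.2 fun I hI => ?_
  obtain ⟨⟨e, he⟩, -⟩ := hI
  simpa [hx e] using he x

/-- The radical of a commutative Frobenius semigroup is its annihilator. -/
theorem IsFrobenius.mem_jacobson_iff [CompleteSpace H] {μ : HTensor H H →L[ℂ] H}
    (h : IsFrobenius μ) (ha : IsAssoc μ) (hc : IsComm μ) {x : H} :
    x ∈ jacobson μ ↔ ∀ y, μ (htmul x y) = 0 := by
  refine ⟨fun hx => ?_, mem_jacobson_of_mul_eq_zero⟩
  have hn := h.isStarNormal_lmul hc x
  have hspec : ∀ c ∈ spectrum ℂ (lmul μ x), c = 0 := by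
    intro c hcs
    by_contra hc0
    have hN : IsStarNormal (ContinuousLinearMap.id ℂ H - lmul μ (c⁻¹ • x)) := by
      have h1 := (Commute.one_right _).sub_right (h.isStarNormal_lmul hc (c⁻¹ • x)).star_comm_self
      have h2 : Commute (star (1 : H →L[ℂ] H)) (1 - lmul μ (c⁻¹ • x)) := by simp
      refine ⟨?_⟩
      rw [star_sub]
      exact h2.sub_left h1
    have hr := range_id_sub_lmul_of_mem_jacobson ha hc ((jacobson μ).smul_mem c⁻¹ hx)
    -- For a normal operator the kernel is the orthogonal complement of the range, so surjectivity
    -- already gives injectivity.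
    have hk := ContinuousLinearMap.IsStarNormal.orthogonal_range hN
    rw [hr, Submodule.top_orthogonal_eq_bot] at hk
    have hu : IsUnit (ContinuousLinearMap.id ℂ H - lmul μ (c⁻¹ • x)) :=
      ContinuousLinearMap.isUnit_iff_bijective.2
        ⟨LinearMap.ker_eq_bot.1 hk.symm, LinearMap.range_eq_top.1 hr⟩
    refine hcs ?_
    have : algebraMap ℂ (H →L[ℂ] H) c - lmul μ x =
        Units.mk0 c hc0 • (ContinuousLinearMap.id ℂ H - lmul μ (c⁻¹ • x)) := by
      ext z
      simp [lmul_smul, Algebra.algebraMap_eq_smul_one, smul_sub, hc0, Units.smul_def]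
    change IsUnit _
    rw [this]
    exact hu.smul _
  have hrad : spectralRadius ℂ (lmul μ x) = 0 := by
    simp only [spectralRadius, ENNReal.iSup_eq_zero]
    intro c hcs
    simp [hspec c hcs]
  rw [IsStarNormal.spectralRadius_eq_nnnorm] at hrad
  have h0 : lmul μ x = 0 := by simpa using hrad
  exact fun y => by simpa using DFunLike.congr_fun h0 y

/-- An element of square zero lies in the radical. -/
theorem IsFrobenius.mem_jacobson_of_sq_eq_zero [CompleteSpace H] {μ : HTensor H H →L[ℂ] H}
    (h : IsFrobenius μ) (ha : IsAssoc μ) (hc : IsComm μ) {x : H} (hx : μ (htmul x x) = 0) :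
    x ∈ jacobson μ := by
  rw [h.mem_jacobson_iff ha hc]
  intro y
  have hn := h.isStarNormal_lmul hc x
  -- L_x L_x y = (xx)y = 0; the final rewrites obtain L_0 = 0 from homogeneity, writing 0 as 0 • 0.
  have hxy : lmul μ x (lmul μ x y) = 0 := by
    rw [lmul_apply, lmul_apply, ← (isAssoc_iff μ).1 ha, hx, ← lmul_apply, ← zero_smul ℂ (0 : H),
      lmul_smul, zero_smul, zero_apply, zero_smul]
  -- By normality L_x†L_x y = 0 as well, so ‖L_x y‖² = 0.
  rw [← ContinuousLinearMap.IsStarNormal.adjoint_apply_eq_zero_iff hn] at hxy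
  rw [← lmul_apply, ← inner_self_eq_zero (𝕜 := ℂ), ← ContinuousLinearMap.adjoint_inner_left, hxy,
    inner_zero_left]

theorem IsFrobenius.isClosed_jacobson [CompleteSpace H] {μ : HTensor H H →L[ℂ] H}
    (h : IsFrobenius μ) (ha : IsAssoc μ) (hc : IsComm μ) : IsClosed (jacobson μ : Set H) := by
  have : (jacobson μ : Set H) = ⋂ y, {x | lmul μ y x = 0} := by
    ext x
    simp [h.mem_jacobson_iff ha hc, hc.mul_comm x]
  rw [this]
  exact isClosed_iInter fun y => isClosed_eq (lmul μ y).continuous continuous_const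

/-- For z in the radical L_x z = 0, so L_x†z = 0 by normality and ⟪z, xy⟫ = ⟪L_x†z, y⟫ = 0. -/
theorem IsFrobenius.mul_mem_orthogonal_jacobson [CompleteSpace H] {μ : HTensor H H →L[ℂ] H}
    (h : IsFrobenius μ) (ha : IsAssoc μ) (hc : IsComm μ) (t : HTensor H H) :
    μ t ∈ (jacobson μ)ᗮ := by
  refine fun z hz => inner_apply_eq_zero (fun x y => ?_) t
  rw [h.mem_jacobson_iff ha hc] at hz
  rw [← lmul_apply, ← ContinuousLinearMap.adjoint_inner_left,
    (ContinuousLinearMap.IsStarNormal.adjoint_apply_eq_zero_iff (h.isStarNormal_lmul hc x) z).2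
      (by simp [hc.mul_comm x z, hz]),
    inner_zero_left]

/-- An element orthogonal to all products lies in the radical. -/
theorem IsFrobenius.mem_jacobson_of_inner_mul [CompleteSpace H] {μ : HTensor H H →L[ℂ] H}
    (h : IsFrobenius μ) (ha : IsAssoc μ) (hc : IsComm μ) {z : H}
    (hz : ∀ x y, inner ℂ z (μ (htmul x y)) = 0) : z ∈ jacobson μ := by
  rw [h.mem_jacobson_iff ha hc]
  intro x
  rw [hc.mul_comm, ← lmul_apply,
    ← ContinuousLinearMap.IsStarNormal.adjoint_apply_eq_zero_iff (h.isStarNormal_lmul hc x)]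
  refine ext_inner_right ℂ fun y => ?_
  rw [ContinuousLinearMap.adjoint_inner_left, lmul_apply, hz, inner_zero_left]

theorem IsFrobenius.isSubalgebra_orthogonal_jacobson [CompleteSpace H] {μ : HTensor H H →L[ℂ] H}
    (h : IsFrobenius μ) (ha : IsAssoc μ) (hc : IsComm μ) :
    IsSubalgebra μ (jacobson μ)ᗮ :=
  fun _ => h.mul_mem_orthogonal_jacobson ha hc _

/-- L_x† maps into Jᗮ, since ⟪z, L_x†u⟫ = ⟪xz, u⟫ = 0 for z ∈ J; its restriction is thus the adjoint
on Jᗮ and remains a module map. -/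
theorem IsFrobenius.restrict_orthogonal_jacobson [CompleteSpace H] {μ : HTensor H H →L[ℂ] H}
    (h : IsFrobenius μ) (ha : IsAssoc μ) (hc : IsComm μ) (hs : IsSubalgebra μ (jacobson μ)ᗮ) :
    IsFrobenius (restrictMul μ (jacobson μ)ᗮ hs) := by
  refine (hc.restrict _ hs).isFrobenius fun x => ?_
  refine ⟨fun u => ⟨ContinuousLinearMap.adjoint (lmul μ x) u, fun z hz => ?_⟩,
    fun u y => ?_, fun u v => ?_⟩
  · rw [h.mem_jacobson_iff ha hc] at hz
    rw [ContinuousLinearMap.adjoint_inner_right, lmul_apply, hc.mul_comm, hz, inner_zero_left]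
  · simp [Submodule.coe_inner, ContinuousLinearMap.adjoint_inner_left]
  · ext
    simp [h.adjoint_lmul_mul]

/-- A radical element of Jᗮ annihilates Jᗮ, in particular itself; having square zero, it lies in J ∩
Jᗮ. -/
theorem IsFrobenius.jacobson_restrict_orthogonal [CompleteSpace H] {μ : HTensor H H →L[ℂ] H}
    (h : IsFrobenius μ) (ha : IsAssoc μ) (hc : IsComm μ) (hs : IsSubalgebra μ (jacobson μ)ᗮ) :
    jacobson (restrictMul μ (jacobson μ)ᗮ hs) = ⊥ := by
  refine (Submodule.eq_bot_iff _).2 fun x hx => ?_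
  rw [(h.restrict_orthogonal_jacobson ha hc hs).mem_jacobson_iff (ha.restrict _ hs)
    (hc.restrict _ hs)] at hx
  have hxx : μ (htmul (x : H) (x : H)) = 0 := by simpa using congrArg Subtype.val (hx x)
  have hxJ := h.mem_jacobson_of_sq_eq_zero ha hc hxx
  exact Subtype.ext (inner_self_eq_zero.1 (x.2 x hxJ))

/-! ### Morphisms and the radical -/

variable {K : Type*} [NormedAddCommGroup K] [InnerProductSpace ℂ K]

/-- The annihilator description alone does not transport along a non-surjective `f`, but square zero
does: f(x)² = f(x²) = 0. -/
theorem IsFrobenius.map_mem_jacobson [CompleteSpace H] [CompleteSpace K]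
    {μ : HTensor H H →L[ℂ] H} {γ : HTensor K K →L[ℂ] K}
    (h : IsFrobenius μ) (ha : IsAssoc μ) (hc : IsComm μ)
    (h' : IsFrobenius γ) (ha' : IsAssoc γ) (hc' : IsComm γ) {f : H →L[ℂ] K}
    (hf : f ∘L μ = γ ∘L hmap f f) {x : H} (hx : x ∈ jacobson μ) : f x ∈ jacobson γ := by
  refine h'.mem_jacobson_of_sq_eq_zero ha' hc' ?_
  rw [h.mem_jacobson_iff ha hc] at hx
  simpa [hx x] using (DFunLike.congr_fun hf (htmul x x)).symm

/-- For z ∈ J(K), the vector f†z is orthogonal to all products, because ⟪f†z, uv⟫ = ⟪z, f(u)f(v)⟫ =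
0. So f†z ∈ J(H), although f† need not be multiplicative. -/
theorem IsFrobenius.map_mem_orthogonal_jacobson [CompleteSpace H] [CompleteSpace K]
    {μ : HTensor H H →L[ℂ] H} {γ : HTensor K K →L[ℂ] K}
    (h : IsFrobenius μ) (ha : IsAssoc μ) (hc : IsComm μ)
    (h' : IsFrobenius γ) (ha' : IsAssoc γ) (hc' : IsComm γ) {f : H →L[ℂ] K}
    (hf : f ∘L μ = γ ∘L hmap f f) {x : H} (hx : x ∈ (jacobson μ)ᗮ) : f x ∈ (jacobson γ)ᗮ := by
  intro z hz
  rw [← ContinuousLinearMap.adjoint_inner_left]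
  refine hx _ (h.mem_jacobson_of_inner_mul ha hc fun u v => ?_)
  rw [ContinuousLinearMap.adjoint_inner_left]
  have h1 : f (μ (htmul u v)) = γ (htmul (f u) (f v)) := by
    simpa using DFunLike.congr_fun hf (htmul u v)
  rw [h1]
  exact h'.mul_mem_orthogonal_jacobson ha' hc' _ z hz

end Mul

/-! ### Adding a null algebra -/

section DirectSum

variable {S Z : Type*} [NormedAddCommGroup S] [InnerProductSpace ℂ S] [NormedAddCommGroup Z]
  [InnerProductSpace ℂ Z]

/-- The inclusion of the first summand in a Hilbert sum. -/
def inlL (S Z : Type*) [NormedAddCommGroup S] [InnerProductSpace ℂ S] [NormedAddCommGroup Z]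
    [InnerProductSpace ℂ Z] : S →L[ℂ] WithLp 2 (S × Z) :=
  ((WithLp.prodContinuousLinearEquiv 2 ℂ S Z).symm : _ →L[ℂ] _) ∘L .inl ℂ S Z

/-- The inclusion of the second summand in a Hilbert sum. -/
def inrL (S Z : Type*) [NormedAddCommGroup S] [InnerProductSpace ℂ S] [NormedAddCommGroup Z]
    [InnerProductSpace ℂ Z] : Z →L[ℂ] WithLp 2 (S × Z) :=
  ((WithLp.prodContinuousLinearEquiv 2 ℂ S Z).symm : _ →L[ℂ] _) ∘L .inr ℂ S Z

@[simp] theorem inlL_apply (s : S) : inlL S Z s = WithLp.toLp 2 (s, 0) := rfl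

/-- The product `(s, z) (s', z') = (s s', 0)` on the Hilbert sum `S ⊕ Z`. -/
def sumMul (μ : HTensor S S →L[ℂ] S) (Z : Type*) [NormedAddCommGroup Z] [InnerProductSpace ℂ Z] :
    HTensor (WithLp 2 (S × Z)) (WithLp 2 (S × Z)) →L[ℂ] WithLp 2 (S × Z) :=
  inlL S Z ∘L μ ∘L hmap (WithLp.fstL 2 ℂ S Z) (WithLp.fstL 2 ℂ S Z)

@[simp] theorem sumMul_htmul (μ : HTensor S S →L[ℂ] S) (x y : WithLp 2 (S × Z)) :
    sumMul μ Z (htmul x y) = WithLp.toLp 2 (μ (htmul x.fst y.fst), 0) := by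
  simp [sumMul]

theorem IsAssoc.sumMul {μ : HTensor S S →L[ℂ] S} (h : IsAssoc μ) : IsAssoc (sumMul μ Z) := by
  rw [isAssoc_iff] at h ⊢
  simp [h]

theorem IsComm.sumMul {μ : HTensor S S →L[ℂ] S} (h : IsComm μ) : IsComm (sumMul μ Z) := by
  rw [isComm_iff] at h ⊢
  intro x y
  simp [h x.fst y.fst]

theorem IsFrobenius.sumMul [CompleteSpace S] [CompleteSpace Z] {μ : HTensor S S →L[ℂ] S}
    (h : IsFrobenius μ) (hc : IsComm μ) : IsFrobenius (sumMul μ Z) := by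
  refine hc.sumMul.isFrobenius fun x =>
    ⟨fun u => WithLp.toLp 2 (ContinuousLinearMap.adjoint (lmul μ x.fst) u.fst, 0),
      fun u y => ?_, fun u v => ?_⟩
  · simp [WithLp.prod_inner_apply, ContinuousLinearMap.adjoint_inner_left]
  · simp [h.adjoint_lmul_mul]

variable [CompleteSpace S] [CompleteSpace Z] {μ : HTensor S S →L[ℂ] S}

/-- The annihilator of the sum is Ann(S) ⊕ Z, and Ann(S) is the radical of S, which vanishes. -/
theorem mem_jacobson_sumMul (h : IsFrobenius μ) (ha : IsAssoc μ) (hc : IsComm μ)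
    (hss : jacobson μ = ⊥) (x : WithLp 2 (S × Z)) : x ∈ jacobson (sumMul μ Z) ↔ x.fst = 0 := by
  rw [(h.sumMul hc).mem_jacobson_iff ha.sumMul hc.sumMul, ← Submodule.mem_bot ℂ, ← hss,
    h.mem_jacobson_iff ha hc]
  refine ⟨fun hx y => ?_, fun hx y => by simp [hx]⟩
  simpa using congrArg WithLp.fst (hx (WithLp.toLp 2 (y, 0)))

theorem mem_orthogonal_jacobson_sumMul (h : IsFrobenius μ) (ha : IsAssoc μ) (hc : IsComm μ)
    (hss : jacobson μ = ⊥) (x : WithLp 2 (S × Z)) :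
    x ∈ (jacobson (sumMul μ Z))ᗮ ↔ x.snd = 0 := by
  simp only [Submodule.mem_orthogonal, mem_jacobson_sumMul h ha hc hss]
  refine ⟨fun hx => ?_, fun hx u hu => by simp [WithLp.prod_inner_apply, hx, hu]⟩
  simpa [WithLp.prod_inner_apply] using hx (WithLp.toLp 2 (0, x.snd)) rfl

end DirectSum

/-! ### The decomposition functor -/

/-- The direct sum of an object and a Hilbert space with zero product. -/
def sumObj (X : CFrobSem.{u}) (Z : Hilb.{u}) : CFrobSem.{u} where
  obj :=
    { carrier := WithLp 2 (X.obj.carrier × Z.carrier)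
      mul := sumMul X.obj.mul Z.carrier
      assoc := X.obj.assoc.sumMul
      comm := X.obj.comm.sumMul }
  property := X.property.sumMul X.obj.comm

theorem isSubalgebra_radical_orthogonal (X : CFrobSem.{u}) :
    IsSubalgebra X.obj.mul (radical X)ᗮ :=
  X.property.isSubalgebra_orthogonal_jacobson X.obj.assoc X.obj.comm

theorem isFrobenius_restrict (X : CFrobSem.{u}) :
    IsFrobenius (restrictMul X.obj.mul (radical X)ᗮ (isSubalgebra_radical_orthogonal X)) :=
  X.property.restrict_orthogonal_jacobson X.obj.assoc X.obj.comm _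

theorem jacobson_restrict (X : CFrobSem.{u}) :
    jacobson (restrictMul X.obj.mul (radical X)ᗮ (isSubalgebra_radical_orthogonal X)) = ⊥ :=
  X.property.jacobson_restrict_orthogonal X.obj.assoc X.obj.comm _

theorem isClosed_radical (X : CFrobSem.{u}) : IsClosed (radical X : Set X.obj.carrier) :=
  X.property.isClosed_jacobson X.obj.assoc X.obj.comm

theorem hom_map_mem_radical (X Y : CFrobSem.{u}) (f : X ⟶ Y) :
    ∀ x ∈ radical X, f.hom.toCLM x ∈ radical Y := fun _ hx =>
  X.property.map_mem_jacobson X.obj.assoc X.obj.comm Y.property Y.obj.assoc Y.obj.comm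
    f.hom.map_mul hx

theorem hom_map_mem_radical_orthogonal (X Y : CFrobSem.{u}) (f : X ⟶ Y) :
    ∀ x ∈ (radical X)ᗮ, f.hom.toCLM x ∈ (radical Y)ᗮ := fun _ hx =>
  X.property.map_mem_orthogonal_jacobson X.obj.assoc X.obj.comm Y.property Y.obj.assoc Y.obj.comm
    f.hom.map_mul hx

/-- The functor `(H, μ) ↦ ((Jᗮ, μ restricted to Jᗮ), J)`. -/
def decomposition : CFrobSem.{u} ⥤ SemisimpleCFrobSem.{u} × Hilb.{u} :=
  Functor.prod' (functorP isSubalgebra_radical_orthogonal isFrobenius_restrict jacobson_restrict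
    hom_map_mem_radical_orthogonal) (functorJ isClosed_radical hom_map_mem_radical)

/-! ### Full faithfulness and essential surjectivity -/

instance (X : CFrobSem.{u}) : CompleteSpace (radical X) := (isClosed_radical X).completeSpace_coe

/-- The product only depends on the components orthogonal to the radical. -/
theorem mul_orthogonalProjection (X : CFrobSem.{u}) (x y : X.obj.carrier) :
    X.obj.mul (htmul ((radical X)ᗮ.orthogonalProjectionOnto x : X.obj.carrier)
      ((radical X)ᗮ.orthogonalProjectionOnto y : X.obj.carrier)) = X.obj.mul (htmul x y) := by
  have hJ := fun z => X.property.mem_jacobson_iff X.obj.assoc X.obj.comm (x := z)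
  have key : ∀ a b, X.obj.mul (htmul ((radical X)ᗮ.orthogonalProjectionOnto a : X.obj.carrier) b) =
      X.obj.mul (htmul a b) := by
    intro a b
    -- The difference lies in Jᗮᗮ, which is J because J is complete.
    have h0 : a - (radical X)ᗮ.orthogonalProjectionOnto a ∈ radical X := by
      have h1 := (radical X)ᗮ.sub_starProjection_mem_orthogonal a
      rwa [Submodule.orthogonal_orthogonal] at h1
    have h2 := (hJ _).1 h0 b
    rw [X.obj.comm.mul_comm, ← lmul_apply, map_sub, sub_eq_zero, lmul_apply, lmul_apply] at h2
    rw [X.obj.comm.mul_comm, ← h2, X.obj.comm.mul_comm]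
  rw [key, X.obj.comm.mul_comm, key, X.obj.comm.mul_comm]

instance : decomposition.{u}.Faithful where
  map_injective {X Y} f g hfg := by
    have hP : f.hom.toCLM.restrict (hom_map_mem_radical_orthogonal X Y f) =
        g.hom.toCLM.restrict (hom_map_mem_radical_orthogonal X Y g) :=
      congrArg (fun k => CSem.Hom.toCLM (InducedCategory.Hom.hom (InducedCategory.Hom.hom
        (Prod.fst k)))) hfg
    have hJ : f.hom.toCLM.restrict (hom_map_mem_radical X Y f) =
        g.hom.toCLM.restrict (hom_map_mem_radical X Y g) :=
      congrArg (fun k => Hilb.Hom.toCLM (Prod.snd k)) hfg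
    refine InducedCategory.Hom.ext (CSem.Hom.ext (ContinuousLinearMap.ext fun x => ?_))
    rw [← (radical X).starProjection_add_starProjection_orthogonal x, map_add, map_add]
    exact congrArg₂ (· + ·)
      (congrArg Subtype.val (DFunLike.congr_fun hJ ((radical X).orthogonalProjectionOnto x)))
      (congrArg Subtype.val (DFunLike.congr_fun hP ((radical X)ᗮ.orthogonalProjectionOnto x)))

/-- The bounded linear map with prescribed restrictions to the radical and its complement. -/
def glue {X Y : CFrobSem.{u}}
    (g : ((radical X)ᗮ : Submodule ℂ X.obj.carrier) →L[ℂ]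
      ((radical Y)ᗮ : Submodule ℂ Y.obj.carrier))
    (h : radical X →L[ℂ] radical Y) : X.obj.carrier →L[ℂ] Y.obj.carrier :=
  (radical Y)ᗮ.subtypeL ∘L g ∘L (radical X)ᗮ.orthogonalProjectionOnto +
    (radical Y).subtypeL ∘L h ∘L (radical X).orthogonalProjectionOnto

/-- The glued map is multiplicative whatever `h` is: products see only the Jᗮ components and lie in
Jᗮ, where the glued map is `g`. -/
instance : decomposition.{u}.Full where
  map_surjective {X Y} := by
    rintro ⟨g, h⟩
    let g₀ : ((radical X)ᗮ : Submodule ℂ X.obj.carrier) →L[ℂ]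
      ((radical Y)ᗮ : Submodule ℂ Y.obj.carrier) := g.hom.hom.toCLM
    let h₀ : radical X →L[ℂ] radical Y := h.toCLM
    have hP : ∀ x : ((radical X)ᗮ : Submodule ℂ X.obj.carrier), glue g₀ h₀ x = g₀ x := fun x => by
      simp [glue, Submodule.orthogonalProjectionOnto_apply_of_mem_orthogonal]
    have hJ : ∀ x : radical X, glue g₀ h₀ x = h₀ x := fun x => by
      have hx : (radical X)ᗮ.orthogonalProjectionOnto (x : X.obj.carrier) = 0 :=
        Submodule.orthogonalProjectionOnto_orthogonal_apply_eq_zero x.2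
      simp [glue, hx]
    have hg : g₀ ∘L restrictMul X.obj.mul _ (isSubalgebra_radical_orthogonal X) =
        restrictMul Y.obj.mul _ (isSubalgebra_radical_orthogonal Y) ∘L hmap g₀ g₀ :=
      g.hom.hom.map_mul
    have hg' : ∀ x y : ((radical X)ᗮ : Submodule ℂ X.obj.carrier),
        g₀ (restrictMul X.obj.mul _ (isSubalgebra_radical_orthogonal X) (htmul x y)) =
        restrictMul Y.obj.mul _ (isSubalgebra_radical_orthogonal Y) (htmul (g₀ x) (g₀ y)) :=
      fun x y => by simpa using DFunLike.congr_fun hg (htmul x y)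
    have hproj : ∀ x, ((radical Y)ᗮ.orthogonalProjectionOnto (glue g₀ h₀ x) : Y.obj.carrier) =
        g₀ ((radical X)ᗮ.orthogonalProjectionOnto x) := fun x => by
      simp [glue]
    refine ⟨ObjectProperty.homMk ⟨glue g₀ h₀, hext fun x y => ?_⟩, Prod.ext ?_ ?_⟩
    · rw [ContinuousLinearMap.comp_apply, ContinuousLinearMap.comp_apply, hmap_htmul,
        ← mul_orthogonalProjection X, ← mul_orthogonalProjection Y, hproj, hproj,
        ← coe_restrictMul_htmul _ _ (isSubalgebra_radical_orthogonal X), hP, hg',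
        coe_restrictMul_htmul]
    · exact InducedCategory.Hom.ext (InducedCategory.Hom.ext (CSem.Hom.ext
        (ContinuousLinearMap.ext fun x => Subtype.ext (hP x))))
    · exact Hilb.Hom.ext (ContinuousLinearMap.ext fun x => Subtype.ext (hJ x))

instance : decomposition.{u}.EssSurj where
  mem_essImage := by
    rintro ⟨S, Z⟩
    have hJ := fun x => mem_jacobson_sumMul (Z := Z.carrier) S.obj.property S.obj.obj.assoc
      S.obj.obj.comm S.property x
    have hP := fun x => mem_orthogonal_jacobson_sumMul (Z := Z.carrier) S.obj.property
      S.obj.obj.assoc S.obj.obj.comm S.property x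
    let X := sumObj S.obj Z
    let p : ((radical X)ᗮ : Submodule ℂ X.obj.carrier) →L[ℂ] S.obj.obj.carrier :=
      WithLp.fstL 2 ℂ _ _ ∘L (radical X)ᗮ.subtypeL
    let i : S.obj.obj.carrier →L[ℂ] ((radical X)ᗮ : Submodule ℂ X.obj.carrier) :=
      (inlL S.obj.obj.carrier Z.carrier).codRestrict _ fun s => (hP _).2 rfl
    let q : radical X →L[ℂ] Z.carrier := WithLp.sndL 2 ℂ _ _ ∘L (radical X).subtypeL
    let j : Z.carrier →L[ℂ] radical X :=
      (inrL S.obj.obj.carrier Z.carrier).codRestrict _ fun s => (hJ _).2 rfl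
    have hp : p ∘L restrictMul X.obj.mul _ (isSubalgebra_radical_orthogonal X) =
        S.obj.obj.mul ∘L hmap p p := hext fun x y => by
      rw [ContinuousLinearMap.comp_apply, ContinuousLinearMap.comp_apply, hmap_htmul]
      exact congrArg WithLp.fst ((coe_restrictMul_htmul X.obj.mul (radical X)ᗮ
        (isSubalgebra_radical_orthogonal X) x y).trans (sumMul_htmul _ _ _))
    have hi : i ∘L S.obj.obj.mul =
        restrictMul X.obj.mul _ (isSubalgebra_radical_orthogonal X) ∘L hmap i i :=
      hext fun x y => by
        rw [ContinuousLinearMap.comp_apply, ContinuousLinearMap.comp_apply, hmap_htmul]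
        exact Subtype.ext ((coe_restrictMul_htmul X.obj.mul (radical X)ᗮ
          (isSubalgebra_radical_orthogonal X) (i x) (i y)).trans (sumMul_htmul _ _ _)).symm
    -- Projection after inclusion is the identity definitionally; the other composite needs the Z
    -- component to vanish on Jᗮ. For `e₂` it is the S component that vanishes on J.
    let e₁ : (decomposition.obj X).1 ≅ S :=
      { hom := ObjectProperty.homMk (ObjectProperty.homMk ⟨p, hp⟩)
        inv := ObjectProperty.homMk (ObjectProperty.homMk ⟨i, hi⟩)
        hom_inv_id := InducedCategory.Hom.ext (InducedCategory.Hom.ext (CSem.Hom.ext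
          (ContinuousLinearMap.ext fun x => Subtype.ext
            (WithLp.ofLp_injective 2 (Prod.ext rfl ((hP _).1 x.2).symm)))))
        inv_hom_id := rfl }
    let e₂ : (decomposition.obj X).2 ≅ Z :=
      { hom := ⟨q⟩
        inv := ⟨j⟩
        hom_inv_id := Hilb.Hom.ext (ContinuousLinearMap.ext fun x => Subtype.ext
          (WithLp.ofLp_injective 2 (Prod.ext ((hJ _).1 x.2).symm rfl)))
        inv_hom_id := rfl }
    exact ⟨X, ⟨e₁.prod e₂⟩⟩

theorem isEquivalence_decomposition : decomposition.{u}.IsEquivalence where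

end HilbFrob

end

theorem mainTheorem6 :
    ∃ (hsub : ∀ X : HilbFrob.CFrobSem.{u},
        HilbFrob.IsSubalgebra X.obj.mul (HilbFrob.radical X)ᗮ)
      (hfrob : ∀ X : HilbFrob.CFrobSem.{u},
        HilbFrob.IsFrobenius (HilbFrob.restrictMul X.obj.mul (HilbFrob.radical X)ᗮ (hsub X)))
      (hss : ∀ X : HilbFrob.CFrobSem.{u},
        HilbFrob.jacobson (HilbFrob.restrictMul X.obj.mul (HilbFrob.radical X)ᗮ (hsub X)) = ⊥)
      (hmapsP : ∀ (X Y : HilbFrob.CFrobSem.{u}) (f : X ⟶ Y),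
        ∀ x ∈ (HilbFrob.radical X)ᗮ, f.hom.toCLM x ∈ (HilbFrob.radical Y)ᗮ)
      (hclosed : ∀ X : HilbFrob.CFrobSem.{u},
        IsClosed (HilbFrob.radical X : Set X.obj.carrier))
      (hmapsJ : ∀ (X Y : HilbFrob.CFrobSem.{u}) (f : X ⟶ Y),
        ∀ x ∈ HilbFrob.radical X, f.hom.toCLM x ∈ HilbFrob.radical Y),
      (CategoryTheory.Functor.prod' (HilbFrob.functorP hsub hfrob hss hmapsP)
        (HilbFrob.functorJ hclosed hmapsJ)).IsEquivalence := by
  exact ⟨HilbFrob.isSubalgebra_radical_orthogonal, HilbFrob.isFrobenius_restrict,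
    HilbFrob.jacobson_restrict, HilbFrob.hom_map_mem_radical_orthogonal,
    HilbFrob.isClosed_radical, HilbFrob.hom_map_mem_radical,
    HilbFrob.isEquivalence_decomposition⟩
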